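/- Let $n,t\ge 0$, let $h_1,\dots,h_t$ be nonnegative integers with $h_1+\dots+h_t\le n$, and let $d_1,\dots,d_t$ be positive integers with $d_1+\dots+d_t=n$. Squares of the $n\times n$ grid are labelled (row, column) as in a matrix. Let $B=B(h_1,d_1;\dots;h_t,d_t)$ be the Ferrers board whose first $d_1$ columns consist of their top $h_1$ squares, whose next $d_2$ columns consist of their top $h_1+h_2$ squares, and so on; these $t$ groups of consecutive columns are called the blocks. For a placement $C$ of $n$ non-attacking rooks on the grid with $k$ rooks on $B$, let $\mathrm{cross}(C,B)$ be the number of squares of the grid that contain a rook or are to the right of a rook, or are above a rook and on $B$, or are below a rook which is off $B$; put $\mathrm{mat}(C,B)=n(n-k)+\mathrm{Area}(B)-\mathrm{cross}(C,B)$. A section $D$ of $B$ of width $w$ is a set of $w$ consecutive columns in which $B$ has constant height. A placement $C$ of $n$ rooks is $D$-standard if, among the rooks in the columns of $D$, those off $B$ are in the left-most columns of $D$ and their columns increase from left to right as their rows go from top to bottom, while for those on $B$ the columns decrease (move from right to left) as the rows go from top to bottom. It is $B$-standard if it is $D$-standard for every section $D$ of $B$ contained in one of the $t$ blocks. Let $M(\mathbf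 d)$ be the set of words $\sigma_1\cdots\sigma_n$ containing exactly $d_i$ letters $i$ for $1\le i\le t$. A placement with rooks on $(1,\tau_1),\dots,(n,\tau_n)$ is a graph of $\sigma\in M(\mathbf d)$ if for each $i$ the column $\tau_i$ lies in block number $\sigma_i$. Write $[k]=(1-q^k)/(1-q)$ and $[k]!=[1][2]\cdots[k]$. Then: (a) Each $\sigma\in M(\mathbf d)$ has exactly one $B$-standard graph $C(\sigma)$. Put $\mathrm{mat}(\sigma,B)=\mathrm{mat}(C(\sigma),B)$. (b) The statistic $\mathrm{mat}(\cdot,B)$ is multiset Mahonian: $$\sum_{\sigma\in M(\mathbf d)}q^{\mathrm{mat}(\sigma,B)}=\frac{[n]!}{[d_1]!\,[d_2]!\cdots[d_t]!}.$$ (c) Let $D$ be a section of $B$ of width $w$, and let $P$ be a placement of $n-w$ non-attacking rooks in the $n-w$ columns outside $D$. Among the placements of $n$ non-attacking rooks that contain all rooks of $P$ there is exactly one $D$-standard placement $E$; it attains the minimum of $\mathrm{mat}(C',B)$ over all such placements $C'$, and $$\sum_{C'\supseteq P}q^{\mathrm{mat}(C',B)}=q^{\mathrm{mat}(E,B)}\,[w]!.$$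 -/

import Mathlib

namespace FerrersMat

/-! Rows and columns of the `n × n` grid are indexed by `Fin n` (row `0` at the top, column `0` at
the left), and a square is a pair `(row, column)`.  A placement of `n` non-attacking rooks on the
grid is a permutation `C` of `Fin n`: the rook of row `i` stands in column `C i`, so the rook of
column `j` stands in row `C.symm j`. -/

/-- Column `j` lies in the `b`-th block of columns, when the columns are cut, from left to right,
into consecutive blocks of widths `d 0, d 1, …`. -/
def InBlock {n t : ℕ} (d : Fin t → ℕ) (b : Fin t) (j : Fin n) : Prop :=
  ∑ i ∈ Finset.Iio b, d i ≤ (j : ℕ) ∧ (j : ℕ) < ∑ i ∈ Finset.Iic b, d i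

instance {n t : ℕ} (d : Fin t → ℕ) (b : Fin t) (j : Fin n) : Decidable (InBlock d b j) :=
  inferInstanceAs (Decidable (_ ∧ _))

/-- The Ferrers board `B(h₁,d₁;…;h_t,d_t)`: the first `d₁` columns consist of their top `h₁`
squares, the next `d₂` columns of their top `h₁ + h₂` squares, and so on. -/
def board (n : ℕ) {t : ℕ} (h d : Fin t → ℕ) : Finset (Fin n × Fin n) :=
  Finset.univ.filter fun s => ∃ b : Fin t, InBlock d b s.2 ∧ (s.1 : ℕ) < ∑ i ∈ Finset.Iic b, h i

/-- The number of squares of `B` in column `j`. -/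
def colHeight {n : ℕ} (B : Finset (Fin n × Fin n)) (j : Fin n) : ℕ :=
  (Finset.univ.filter fun i : Fin n => (i, j) ∈ B).card

/-- The number of rooks of `C` on `B`. -/
def hits {n : ℕ} (C : Equiv.Perm (Fin n)) (B : Finset (Fin n × Fin n)) : ℕ :=
  (Finset.univ.filter fun i : Fin n => (i, C i) ∈ B).card

/-- The number of squares `(i, j)` of the grid that contain a rook or are to the right of a rook,
or are above a rook and on `B`, or are below a rook that is off `B`. -/
def cross {n : ℕ} (C : Equiv.Perm (Fin n)) (B : Finset (Fin n × Fin n)) : ℕ :=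
  (Finset.univ.filter fun s : Fin n × Fin n =>
    C s.1 ≤ s.2 ∨
    (s.1 < C.symm s.2 ∧ s ∈ B) ∨
    (C.symm s.2 < s.1 ∧ (C.symm s.2, s.2) ∉ B)).card

/-- `mat(C,B) = n(n-k) + Area(B) - cross(C,B)`, with `k` the number of rooks on `B`. -/
def mat {n : ℕ} (C : Equiv.Perm (Fin n)) (B : Finset (Fin n × Fin n)) : ℤ :=
  (n : ℤ) * ((n : ℤ) - (hits C B : ℤ)) + (B.card : ℤ) - (cross C B : ℤ)

/-- A section of `B`: a set of consecutive columns in which `B` has constant height. -/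
def IsSection {n : ℕ} (B : Finset (Fin n × Fin n)) (D : Finset (Fin n)) : Prop :=
  (D : Set (Fin n)).OrdConnected ∧ ∀ j ∈ D, ∀ k ∈ D, colHeight B j = colHeight B k

/-- `C` is `D`-standard: among the rooks in the columns of `D`, those off `B` are in the left-most
columns of `D` and in descending order, those on `B` are in ascending order. -/
structure IsStandard {n : ℕ} (B : Finset (Fin n × Fin n)) (D : Finset (Fin n))
    (C : Equiv.Perm (Fin n)) : Prop where
  off_left : ∀ i k : Fin n, C i ∈ D → C k ∈ D → (i, C i) ∉ B → (k, C k) ∈ B → C i < C k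
  off_descending : ∀ i k : Fin n, C i ∈ D → C k ∈ D → (i, C i) ∉ B → (k, C k) ∉ B →
    i < k → C i < C k
  on_ascending : ∀ i k : Fin n, C i ∈ D → C k ∈ D → (i, C i) ∈ B → (k, C k) ∈ B →
    i < k → C k < C i

/-- `C` is `B`-standard, for `B = B(h₁,d₁;…;h_t,d_t)`: it is `D`-standard for every section `D`
of `B` that is contained in one of the `t` blocks of columns.  (If `h₂, …, h_t` are positive, every
nonempty section is contained in a block; if some of them vanish, the same board has several
presentations, and the notion refers to the presentation at hand.) -/
def IsBoardStandard {n t : ℕ} (h d : Fin t → ℕ) (C : Equiv.Perm (Fin n)) : Prop :=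
  ∀ D : Finset (Fin n), IsSection (board n h d) D → (∃ b : Fin t, ∀ j ∈ D, InBlock d b j) →
    IsStandard (board n h d) D C

/-- `M(d)`: the words of length `n` in which each letter `b` occurs exactly `d b` times. -/
def multisetPerms (n : ℕ) {t : ℕ} (d : Fin t → ℕ) : Finset (Fin n → Fin t) :=
  Finset.univ.filter fun σ => ∀ b : Fin t, (Finset.univ.filter fun i => σ i = b).card = d b

/-- `C` is a graph of the word `σ`: replacing each column number in the list `C 0, C 1, …` by the
index of the block that contains it gives `σ`. -/
def IsGraph {n t : ℕ} (d : Fin t → ℕ) (σ : Fin n → Fin t) (C : Equiv.Perm (Fin n)) : Prop :=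
  ∀ i : Fin n, InBlock d (σ i) (C i)

/-- The `B`-standard graph of `σ` (some such graph; that there is exactly one for `σ ∈ M(d)` is
part of the theorem). -/
noncomputable def standardGraph {n t : ℕ} (h d : Fin t → ℕ) (σ : Fin n → Fin t) :
    Equiv.Perm (Fin n) :=
  Classical.epsilon fun C => IsGraph d σ C ∧ IsBoardStandard h d C

/-- `mat(σ,B) = mat(C(σ),B)`, with `C(σ)` the `B`-standard graph of `σ`. -/
noncomputable def matWord {n t : ℕ} (h d : Fin t → ℕ) (σ : Fin n → Fin t) : ℤ :=
  mat (standardGraph h d σ) (board n h d)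

/-- The indeterminate `q` of the field `ℚ(q)`. -/
noncomputable def q : RatFunc ℚ := RatFunc.X

/-- `[k] = (1 - q^k) / (1 - q)`. -/
noncomputable def qNumber (k : ℕ) : RatFunc ℚ := (1 - q ^ k) / (1 - q)

/-- `[k]! = [1][2]⋯[k]`. -/
noncomputable def qFactorial (k : ℕ) : RatFunc ℚ := ∏ i ∈ Finset.Icc 1 k, qNumber i

/-- The `q`-multinomial coefficient `[n]! / ([d₁]!⋯[d_t]!)`. -/
noncomputable def qMultinomial (n : ℕ) {t : ℕ} (d : Fin t → ℕ) : RatFunc ℚ :=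
  qFactorial n / ∏ i, qFactorial (d i)

/-- `P` is a placement of `n - #D` non-attacking rooks in the columns outside `D`. -/
structure IsPlacementOutside {n : ℕ} (D : Finset (Fin n)) (P : Finset (Fin n × Fin n)) : Prop where
  outside : ∀ s ∈ P, s.2 ∉ D
  card_eq : P.card + D.card = n
  row_inj : ∀ s ∈ P, ∀ s' ∈ P, s.1 = s'.1 → s = s'
  col_inj : ∀ s ∈ P, ∀ s' ∈ P, s.2 = s'.2 → s = s'

/-- The placements of `n` non-attacking rooks on the grid that contain all the rooks of `P`. -/
def extensions {n : ℕ} (P : Finset (Fin n × Fin n)) : Finset (Equiv.Perm (Fin n)) :=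
  Finset.univ.filter fun C => ∀ s ∈ P, C s.1 = s.2

end FerrersMat

namespace FerrersMat

open Finset

/-! ### `q`-numbers and `q`-factorials. -/

section

/-! Two facts carry the proof.

The first is local (`exists_isSorted`). Partition the columns into intervals of constant height and
prescribe, for each row, the class of columns in which its rook stands. Two rooks of one class
contribute to `mat` the indicator of an inversion for the order `rowKey`, minus a term symmetric in
the two rows (`pairWeight_self`); two rooks of different classes never change their left-right
order. Hence `mat` is a constant plus the number of inversions inside classes
(`mat_sub_inversions`). Exactly one placement has no inversion, it is the standard one, and the
inversions are counted by the product of the `[class size]!` (`sum_inversions`). With `D` as one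
class and singletons elsewhere this is (c); with the blocks as classes it gives (a), and the sum
over the graphs of a word `σ` is `q ^ mat(σ,B)` times the product of the `[d_b]!`.

The second is global (`sum_mat`): over all placements, `q ^ mat` sums to `[n]!`. If the first `w`
columns all had height `h`, their placements in a row set `U` would sum to `[w]! * q ^ minWeight h
U`. Raising this common height to that of the next column leaves the total unchanged
(`sum_minWeight_congr`, based on `columnSum_congr`); the next column is then absorbed with a factor
`[w + 1]` (`sum_columnSum_cons`). Splitting the global sum by words and dividing by the `[d_b]!`
gives (b). -/

lemma q_ne_zero : q ≠ 0 := RatFunc.X_ne_zero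

lemma one_sub_q_ne_zero : (1 : RatFunc ℚ) - q ≠ 0 := by
  have h : (Polynomial.X : Polynomial ℚ) ≠ 1 := by
    intro h
    simpa using congrArg (Polynomial.eval 0) h
  intro h'
  refine h (RatFunc.algebraMap_injective ℚ ?_)
  rw [RatFunc.algebraMap_X, map_one]
  exact (sub_eq_zero.1 h').symm

lemma qNumber_zero : qNumber 0 = 0 := by simp [qNumber]

lemma qNumber_succ (k : ℕ) : qNumber (k + 1) = q ^ (k : ℤ) + qNumber k := by
  have := one_sub_q_ne_zero
  rw [qNumber, qNumber, zpow_natCast]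
  field_simp
  ring

lemma qNumber_one : qNumber 1 = 1 := by
  rw [qNumber_succ, qNumber_zero]; simp

lemma q_pow_ne_one {k : ℕ} (hk : 0 < k) : q ^ k ≠ 1 := by
  intro h
  have h' : (Polynomial.X : Polynomial ℚ) ^ k = 1 := by
    refine RatFunc.algebraMap_injective ℚ ?_
    rw [map_pow, RatFunc.algebraMap_X, map_one]
    exact h
  have := congrArg (Polynomial.eval 0) h'
  simp [hk.ne'] at this

lemma qNumber_ne_zero {k : ℕ} (hk : 0 < k) : qNumber k ≠ 0 :=
  div_ne_zero (sub_ne_zero.2 (q_pow_ne_one hk).symm) one_sub_q_ne_zero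

lemma qFactorial_zero : qFactorial 0 = 1 := by simp [qFactorial]

lemma qFactorial_succ (k : ℕ) : qFactorial (k + 1) = qNumber (k + 1) * qFactorial k := by
  rw [qFactorial, Finset.prod_Icc_succ_top (by omega), mul_comm, qFactorial]

lemma qFactorial_ne_zero (k : ℕ) : qFactorial k ≠ 0 :=
  prod_ne_zero_iff.2 fun _ hi => qNumber_ne_zero (mem_Icc.1 hi).1

/-- The ranks of the elements of a finite set, ordered by an injective key, sum up to `[#S]`. -/
lemma sum_rank {α : Type*} [DecidableEq α] (S : Finset α) (K : α → ℕ)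
    (hK : Set.InjOn K S) :
    ∑ r ∈ S, q ^ ((#{s ∈ S | K s < K r} : ℕ) : ℤ) = qNumber #S := by
  induction S using Finset.induction_on_max_value K with
  | empty => simp [qNumber_zero]
  | insert a S ha hmax ih =>
    have hlt : ∀ s ∈ S, K s < K a := fun s hs => lt_of_le_of_ne (hmax s hs) fun h =>
      ha (hK (by simp [hs]) (by simp) h ▸ hs)
    rw [sum_insert ha, card_insert_of_notMem ha, qNumber_succ, ← ih (hK.mono (by simp))]
    congr 1
    · rw [filter_insert, if_neg (lt_irrefl _), filter_true_of_mem hlt]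
    · refine sum_congr rfl fun r hr => ?_
      rw [filter_insert, if_neg (hlt r hr).not_gt]

/-! ### Placing rooks column by column on a board with nondecreasing heights. -/

/-- The contribution to `mat` of a column of height `h` whose rook stands in row `r`, when `U` is
the set of rows occupied by the rooks of the columns further left. -/
def colWeight {n : ℕ} (h : ℕ) (U : Finset (Fin n)) (r : Fin n) : ℤ :=
  if (r : ℕ) < h then
    (#{i : Fin n | i ∉ U ∧ r < i ∧ (i : ℕ) < h} : ℤ) - #{i : Fin n | i ∈ U ∧ h ≤ (i : ℕ)}
  else h + #{i : Fin n | i ∉ U ∧ h ≤ (i : ℕ) ∧ i < r}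

/-- The sum of `q ^ weight` over the ways of placing rooks in further columns of heights `L`, when
the rows in `U` are occupied already. -/
noncomputable def columnSum {n : ℕ} : List ℕ → Finset (Fin n) → RatFunc ℚ
  | [], _ => 1
  | a :: L, U => ∑ r ∈ Uᶜ, q ^ colWeight a U r * columnSum L (insert r U)

/-- Among the rows above all the heights still to come, only the number of occupied ones matters. -/
lemma columnSum_congr {n : ℕ} (a : ℕ) (L : List ℕ) (hL : ∀ b ∈ L, a ≤ b) :
    ∀ U U' : Finset (Fin n), #U = #U' → (∀ i : Fin n, a ≤ (i : ℕ) → (i ∈ U ↔ i ∈ U')) →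
      columnSum L U = columnSum L U' := by
  induction L with
  | nil => intros; rfl
  | cons b L ih =>
    intro U U' hc hU
    have hb : a ≤ b := hL b (by simp)
    replace ih := ih fun c hc => hL c (by simp [hc])
    -- For a free row `r < a`, the weight is its rank from the bottom among the free rows `< a`,
    -- plus a term that does not depend on `r`. The key `n - s` encodes the order from bottom to
    -- top.
    have low : ∀ V : Finset (Fin n), ∀ r ∈ {r ∈ Vᶜ | r.val < a},
        colWeight b V r = (#{s ∈ {r ∈ Vᶜ | r.val < a} | n - s.val < n - r.val} : ℤ) +
          (#{i : Fin n | i ∉ V ∧ a ≤ (i : ℕ) ∧ (i : ℕ) < b} -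
            #{i : Fin n | i ∈ V ∧ b ≤ (i : ℕ)} : ℤ) := by
      intro V r hr
      simp only [mem_filter, mem_compl] at hr
      rw [colWeight, if_pos (by omega), ← add_sub_assoc, ← Nat.cast_add, ← card_union_of_disjoint]
      · congr 3
        ext i
        simp only [mem_filter, mem_univ, true_and, mem_union, mem_compl, Fin.lt_def]
        by_cases hi : i ∈ V <;> simp [hi]
        omega
      · rw [disjoint_left]
        intro i hi hi'
        simp only [mem_filter, mem_univ, true_and] at hi hi'
        omega
    have lowSum : ∀ (V : Finset (Fin n)) (z : RatFunc ℚ),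
        (∀ r ∈ {r ∈ Vᶜ | r.val < a}, columnSum L (insert r V) = z) →
        ∑ r ∈ {r ∈ Vᶜ | r.val < a}, q ^ colWeight b V r * columnSum L (insert r V) =
          qNumber #{r ∈ Vᶜ | r.val < a} * (q ^ (#{i : Fin n | i ∉ V ∧ a ≤ (i : ℕ) ∧ (i : ℕ) < b} -
            #{i : Fin n | i ∈ V ∧ b ≤ (i : ℕ)} : ℤ) * z) := by
      intro V z hz
      rw [← sum_rank _ (fun s : Fin n => n - (s : ℕ)), sum_mul]
      · refine sum_congr rfl fun r hr => ?_
        rw [hz r hr, low V r hr, zpow_add₀ q_ne_zero, mul_assoc]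
      · intro s _ s' _ h
        simp only at h
        exact Fin.ext (by omega)
    have high : {r ∈ Uᶜ | ¬ r.val < a} = {r ∈ U'ᶜ | ¬ r.val < a} := by
      ext r
      simp only [mem_filter, mem_compl, not_lt]
      have := hU r
      tauto
    have hcard : #{r ∈ Uᶜ | r.val < a} = #{r ∈ U'ᶜ | r.val < a} := by
      have h1 := card_filter_add_card_filter_not (s := Uᶜ) (fun r : Fin n => (r : ℕ) < a)
      have h2 := card_filter_add_card_filter_not (s := U'ᶜ) (fun r : Fin n => (r : ℕ) < a)
      rw [card_compl] at h1 h2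
      rw [high] at h1
      omega
    have hmid : ({i : Fin n | i ∉ U ∧ a ≤ (i : ℕ) ∧ (i : ℕ) < b} : Finset (Fin n)) =
        ({i : Fin n | i ∉ U' ∧ a ≤ (i : ℕ) ∧ (i : ℕ) < b} : Finset (Fin n)) := by
      ext i
      simp only [mem_filter, mem_univ, true_and]
      have := hU i
      tauto
    have htop : ({i : Fin n | i ∈ U ∧ b ≤ (i : ℕ)} : Finset (Fin n)) =
        ({i : Fin n | i ∈ U' ∧ b ≤ (i : ℕ)} : Finset (Fin n)) := by
      ext i
      simp only [mem_filter, mem_univ, true_and]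
      refine and_congr_left fun hi => hU i (hb.trans hi)
    rw [columnSum, columnSum, ← sum_filter_add_sum_filter_not Uᶜ fun r : Fin n => (r : ℕ) < a,
      ← sum_filter_add_sum_filter_not U'ᶜ fun r : Fin n => (r : ℕ) < a]
    congr 1
    -- By induction every low row leads to the same remaining sum `z`, for `U` and `U'` alike. If
    -- there is no free low row, both sums are empty and any `z` serves.
    · obtain ⟨z, hz, hz'⟩ : ∃ z, (∀ r ∈ {r ∈ Uᶜ | r.val < a}, columnSum L (insert r U) = z) ∧
          ∀ r ∈ {r ∈ U'ᶜ | r.val < a}, columnSum L (insert r U') = z := by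
        have key : ∀ V V' : Finset (Fin n), #V = #V' →
            (∀ i : Fin n, a ≤ (i : ℕ) → (i ∈ V ↔ i ∈ V')) → ∀ r ∈ {r ∈ Vᶜ | r.val < a},
            ∀ r' ∈ {r ∈ V'ᶜ | r.val < a},
            columnSum L (insert r V) = columnSum L (insert r' V') := by
          intro V V' hc hV r hr r' hr'
          simp only [mem_filter, mem_compl] at hr hr'
          refine ih _ _ ?_ fun i hi => ?_
          · rw [card_insert_of_notMem hr.1, card_insert_of_notMem hr'.1, hc]
          · have h1 : i ≠ r := fun h => by omega
            have h2 : i ≠ r' := fun h => by omega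
            simp [h1, h2, hV i hi]
        rcases eq_empty_or_nonempty {r ∈ Uᶜ | r.val < a} with h0 | ⟨r, hr⟩
        · rw [h0, card_empty, eq_comm, card_eq_zero] at hcard
          rw [h0, hcard]
          exact ⟨0, by simp, by simp⟩
        · exact ⟨columnSum L (insert r U), fun r' hr' => key _ _ rfl (fun _ _ => Iff.rfl) _ hr' _ hr,
            fun r' hr' => (key _ _ hc hU _ hr _ hr').symm⟩
      rw [lowSum U z hz, lowSum U' z hz', hcard, hmid, htop]
    · rw [high]
      refine sum_congr rfl fun r hr => ?_
      simp only [mem_filter, mem_compl, not_lt] at hr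
      have hrU : r ∉ U := by rw [hU r hr.2]; exact hr.1
      congr 1
      · congr 1
        rw [colWeight, colWeight, htop]
        have h1 : ({i : Fin n | i ∉ U ∧ r < i ∧ (i : ℕ) < b} : Finset (Fin n)) =
            ({i : Fin n | i ∉ U' ∧ r < i ∧ (i : ℕ) < b} : Finset (Fin n)) := by
          ext i
          simp only [mem_filter, mem_univ, true_and]
          refine and_congr_left fun hi => not_congr (hU i ?_)
          have := Fin.lt_def.1 hi.1
          omega
        have h2 : ({i : Fin n | i ∉ U ∧ b ≤ (i : ℕ) ∧ i < r} : Finset (Fin n)) =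
            ({i : Fin n | i ∉ U' ∧ b ≤ (i : ℕ) ∧ i < r} : Finset (Fin n)) := by
          ext i
          simp only [mem_filter, mem_univ, true_and]
          exact and_congr_left fun hi => not_congr (hU i (hb.trans hi.1))
        rw [h1, h2]
      · refine ih _ _ ?_ fun i hi => ?_
        · rw [card_insert_of_notMem hrU, card_insert_of_notMem hr.1, hc]
        · simp [hU i hi]

/-- The order of the rows in which those above height `h` come first, from bottom to top. -/
def flipKey (h i : ℕ) : ℕ := if i < h then h - 1 - i else i

/-- The minimal weight of the placements of rooks of columns of height `h` in the rows of `U`. -/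
def minWeight {n : ℕ} (h : ℕ) (U : Finset (Fin n)) : ℕ :=
  ∑ r ∈ U, #{i ∈ Uᶜ | flipKey h i.val < flipKey h r}

lemma flipKey_flipKey (h i : ℕ) : flipKey h (flipKey h i) = i := by
  unfold flipKey
  split_ifs <;> omega

/-- `flipKey` as a permutation of the rows. -/
def flipPerm {n : ℕ} (h : ℕ) (hh : h ≤ n) : Equiv.Perm (Fin n) :=
  Function.Involutive.toPerm
    (fun i => ⟨flipKey h i, by have := i.2; unfold flipKey; split_ifs <;> omega⟩)
    fun i => Fin.ext (flipKey_flipKey h i)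

lemma minWeight_map {n : ℕ} (h h' : ℕ) (ρ : Equiv.Perm (Fin n))
    (hρ : ∀ i, flipKey h' (ρ i) = flipKey h i) (U : Finset (Fin n)) :
    minWeight h' (U.map ρ.toEmbedding) = minWeight h U := by
  rw [minWeight, minWeight, sum_map]
  refine sum_congr rfl fun r _ => ?_
  conv_rhs => rw [← card_map ρ.toEmbedding]
  congr 1
  ext i
  obtain ⟨i, rfl⟩ := ρ.surjective i
  simp [hρ]

/-- The permutation `ρ` of the rows that turns the order `flipKey h` into `flipKey a` transports
`minWeight`. It fixes every row `≥ a`, so `columnSum_congr` shows that the columns still to come do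
not notice it. -/
lemma sum_minWeight_congr {n : ℕ} (h a w : ℕ) (L : List ℕ) (ha : h ≤ a) (han : a ≤ n)
    (hL : ∀ b ∈ L, a ≤ b) :
    ∑ U ∈ powersetCard w (univ : Finset (Fin n)), q ^ (minWeight h U : ℤ) * columnSum L U =
      ∑ U ∈ powersetCard w (univ : Finset (Fin n)), q ^ (minWeight a U : ℤ) * columnSum L U := by
  set ρ : Equiv.Perm (Fin n) := (flipPerm h (ha.trans han)).trans (flipPerm a han)
  have hval : ∀ i : Fin n, (ρ i : ℕ) = flipKey a (flipKey h i) := fun i => rfl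
  refine sum_equiv (Equiv.finsetCongr ρ) (fun U => by simp [mem_powersetCard]) fun U _ => ?_
  rw [Equiv.finsetCongr_apply, minWeight_map h a ρ fun i => by rw [hval, flipKey_flipKey]]
  congr 1
  refine columnSum_congr a L hL _ _ (by simp) fun i hi => ?_
  have : ρ i = i := by
    refine Fin.ext ?_
    rw [hval]
    unfold flipKey
    split_ifs <;> omega
  conv_rhs => rw [← this]
  simp

/-- Removing `r` from `U` loses the pairs formed by `r` and an earlier free row, and makes `r`
itself a free row preceding the later elements of `U`. -/
lemma minWeight_erase {n : ℕ} (h : ℕ) (U : Finset (Fin n)) (r : Fin n) (hr : r ∈ U) :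
    minWeight h (U.erase r) + #{i ∈ Uᶜ | flipKey h i.val < flipKey h r} =
      minWeight h U + #{s ∈ U | flipKey h r < flipKey h s.val} := by
  have h1 : ∀ s : Fin n, #{i ∈ (U.erase r)ᶜ | flipKey h i.val < flipKey h s.val} =
      #{i ∈ Uᶜ | flipKey h i.val < flipKey h s.val} + if flipKey h r < flipKey h s then 1 else 0 := by
    intro s
    rw [compl_erase, filter_insert]
    split_ifs
    · rw [card_insert_of_notMem (by simp [hr])]
    · rfl
  rw [minWeight, minWeight, sum_congr rfl fun s _ => h1 s, sum_add_distrib,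
    ← add_sum_erase U _ hr, card_filter (fun s : Fin n => flipKey h r < flipKey h s) U,
    ← add_sum_erase U (fun s : Fin n => if flipKey h r < flipKey h s then 1 else 0) hr,
    if_neg (lt_irrefl _)]
  ring

/-- Summation over the row of the last of the columns of height `h`. -/
lemma sum_erase_minWeight {n : ℕ} (h : ℕ) (hh : h ≤ n) (U : Finset (Fin n)) :
    ∑ r ∈ U, q ^ (minWeight h (U.erase r) : ℤ) * q ^ colWeight h (U.erase r) r =
      qNumber #U * q ^ (minWeight h U : ℤ) := by
  -- This key lists the rows on the board from top to bottom, then those off the board from bottom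
  -- to top. The exponent belonging to `r` is `minWeight h U` plus the rank of `r` in `U` for this
  -- key.
  have hK : Set.InjOn (fun r : Fin n => if (r : ℕ) < h then (r : ℕ) else 2 * n - r) U := by
    intro r _ s _ hrs
    have := r.2
    have := s.2
    simp only at hrs
    refine Fin.ext ?_
    split_ifs at hrs <;> omega
  rw [← sum_rank U _ hK, sum_mul]
  refine sum_congr rfl fun r hr => ?_
  rw [← zpow_add₀ q_ne_zero, ← zpow_add₀ q_ne_zero]
  congr 1
  have h1 := minWeight_erase h U r hr
  have h2 : colWeight h (U.erase r) r + #{s ∈ U | flipKey h r < flipKey h s.val} =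
      #{i ∈ Uᶜ | flipKey h i.val < flipKey h r} +
      #{s ∈ U | (if s.val < h then s.val else 2 * n - s.val) <
        (if (r : ℕ) < h then (r : ℕ) else 2 * n - r)} := by
    unfold colWeight
    have hcard : (h : ℤ) = ∑ i : Fin n, if (i : ℕ) < h then 1 else 0 := by
      rw [sum_boole, Fin.card_filter_val_lt]
      simp [hh]
    have e1 : ∀ p : Fin n → Prop, ∀ [DecidablePred p], (#{s ∈ U | p s} : ℤ) =
        ∑ i : Fin n, if i ∈ U ∧ p i then 1 else 0 := by
      intro p _
      rw [sum_boole]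
      congr 2
      ext; simp
    have e2 : ∀ p : Fin n → Prop, ∀ [DecidablePred p], (#{s ∈ Uᶜ | p s} : ℤ) =
        ∑ i : Fin n, if i ∉ U ∧ p i then 1 else 0 := by
      intro p _
      rw [sum_boole]
      congr 2
      ext; simp
    split_ifs with hrh
    · rw [e1, e1, e2, ← sum_boole, ← sum_boole, ← sum_sub_distrib, ← sum_add_distrib,
        ← sum_add_distrib]
      -- All counts are now sums of indicators over the rows, and the identity holds row by row.
      refine sum_congr rfl fun i _ => ?_
      have hi := i.2
      have hri : i = r ↔ (i : ℕ) = r := Fin.ext_iff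
      simp only [flipKey, mem_erase, Fin.lt_def, hri, ne_eq]
      by_cases hiU : i ∈ U <;> simp only [hiU] <;> grind
    · rw [hcard, e1, e1, e2, ← sum_boole, ← sum_add_distrib, ← sum_add_distrib,
        ← sum_add_distrib]
      refine sum_congr rfl fun i _ => ?_
      have hi := i.2
      have hr2 := r.2
      have hri : i = r ↔ (i : ℕ) = r := Fin.ext_iff
      simp only [flipKey, mem_erase, Fin.lt_def, hri, ne_eq]
      by_cases hiU : i ∈ U <;> simp only [hiU] <;> grind
  have h1' : (minWeight h (U.erase r) : ℤ) + #{i ∈ Uᶜ | flipKey h i.val < flipKey h r} =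
      minWeight h U + #{s ∈ U | flipKey h r < flipKey h s.val} := by exact_mod_cast h1
  linarith

/-- Pairs of a `w`-set and a row outside it correspond to pairs of a `(w + 1)`-set and one of its
rows; `sum_erase_minWeight` then sums over that row. -/
lemma sum_columnSum_cons {n : ℕ} (a w : ℕ) (L : List ℕ) (ha : a ≤ n) :
    ∑ U ∈ powersetCard w (univ : Finset (Fin n)), q ^ (minWeight a U : ℤ) * columnSum (a :: L) U =
      qNumber (w + 1) *
        ∑ U ∈ powersetCard (w + 1) (univ : Finset (Fin n)),
          q ^ (minWeight a U : ℤ) * columnSum L U := by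
  have h1 : ∀ U ∈ powersetCard (w + 1) (univ : Finset (Fin n)),
      qNumber (w + 1) * (q ^ (minWeight a U : ℤ) * columnSum L U) =
        ∑ r ∈ U, q ^ (minWeight a (U.erase r) : ℤ) * q ^ colWeight a (U.erase r) r *
          columnSum L U := by
    intro U hU
    rw [← (mem_powersetCard.1 hU).2, ← mul_assoc, ← sum_erase_minWeight a ha U, sum_mul]
  rw [mul_sum, sum_congr rfl h1]
  simp only [columnSum, mul_sum]
  rw [sum_sigma', sum_sigma']
  refine sum_bij' (fun x _ => ⟨insert x.2 x.1, x.2⟩) (fun x _ => ⟨x.1.erase x.2, x.2⟩) ?_ ?_ ?_ ?_ ?_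
  · rintro ⟨U, r⟩ h
    simp only [mem_sigma, mem_powersetCard, subset_univ, true_and, mem_compl] at h ⊢
    exact ⟨by rw [card_insert_of_notMem h.2, h.1], mem_insert_self _ _⟩
  · rintro ⟨U, r⟩ h
    simp only [mem_sigma, mem_powersetCard, subset_univ, true_and, mem_compl] at h ⊢
    exact ⟨by rw [card_erase_of_mem h.2, h.1]; rfl, notMem_erase _ _⟩
  · rintro ⟨U, r⟩ h
    simp only [mem_sigma, mem_compl] at h
    simp [erase_insert h.2]
  · rintro ⟨U, r⟩ h
    simp only [mem_sigma] at h
    simp [insert_erase h.2]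
  · rintro ⟨U, r⟩ h
    simp only [mem_sigma, mem_compl] at h
    simp only [erase_insert h.2, mul_assoc]

/-- Both `h` and `w` vary in the induction: each step raises `h` to the first height of the list and
`w` to `w + 1`. At the end only `U = univ` is left, with `minWeight` zero. -/
lemma sum_minWeight_columnSum {n : ℕ} (L : List ℕ) :
    ∀ h w : ℕ, L.Pairwise (· ≤ ·) → (∀ b ∈ L, h ≤ b ∧ b ≤ n) → h ≤ n → w + L.length = n →
      qFactorial w * ∑ U ∈ powersetCard w (univ : Finset (Fin n)),
        q ^ (minWeight h U : ℤ) * columnSum L U = qFactorial n := by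
  induction L with
  | nil =>
    intro h w _ _ _ hw
    obtain rfl : w = n := by simpa using hw
    have : powersetCard w (univ : Finset (Fin w)) = {univ} := by
      have := powersetCard_self (univ : Finset (Fin w))
      rwa [card_univ, Fintype.card_fin] at this
    simp [this, minWeight, columnSum]
  | cons a L ih =>
    intro h w hL hb hh hw
    rw [List.pairwise_cons] at hL
    have ha := hb a (by simp)
    rw [sum_minWeight_congr h a w _ ha.1 ha.2, sum_columnSum_cons a w L ha.2, ← mul_assoc,
      mul_comm (qFactorial w), ← qFactorial_succ]
    · refine ih a (w + 1) hL.2 (fun b hb' => ⟨hL.1 b hb', (hb b (by simp [hb'])).2⟩) ha.2 ?_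
      simp at hw
      omega
    · intro b hb'
      rcases List.mem_cons.1 hb' with rfl | hb'
      exacts [le_rfl, hL.1 b hb']

/-- For nondecreasing column heights, the total sum is `[n]!`. -/
theorem columnSum_empty {n : ℕ} (L : List ℕ) (hL : L.Pairwise (· ≤ ·)) (hn : ∀ b ∈ L, b ≤ n)
    (hlen : L.length = n) : columnSum L (∅ : Finset (Fin n)) = qFactorial n := by
  have := sum_minWeight_columnSum (n := n) L 0 0 hL (fun b hb => ⟨b.zero_le, hn b hb⟩) n.zero_le
    (by simpa using hlen)
  simpa [qFactorial_zero, minWeight] using this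

end

/-! ### Colour-preserving rearrangements and their inversions. -/

section

variable {n : ℕ} {β : Type*}

lemma color_mul_swap (col σ : Fin n → β) (π₀ : Equiv.Perm (Fin n))
    (h₀ : ∀ j, σ (π₀ j) = col j) (a k : Fin n) (hk : col k = col a) (j : Fin n) :
    σ ((π₀ * Equiv.swap a k) j) = col j := by
  rw [Equiv.Perm.mul_apply, h₀, Equiv.swap_apply_def]
  split_ifs with h1 h2
  · rw [h1, hk]
  · rw [h2, hk]
  · rfl

variable [DecidableEq β]

/-- The rearrangements of `π₀` in the columns of `D` that match the colours `col` of the columns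
with the colours `σ` of the rows. Here permutations send columns to rows. -/
def rearrangements (col σ : Fin n → β) (D : Finset (Fin n)) (π₀ : Equiv.Perm (Fin n)) :
    Finset (Equiv.Perm (Fin n)) :=
  {π | (∀ j ∉ D, π j = π₀ j) ∧ ∀ j, σ (π j) = col j}

lemma mem_rearrangements {col σ : Fin n → β} {D : Finset (Fin n)} {π₀ π : Equiv.Perm (Fin n)} :
    π ∈ rearrangements col σ D π₀ ↔ (∀ j ∉ D, π j = π₀ j) ∧ ∀ j, σ (π j) = col j := by
  simp [rearrangements]

lemma rearrangements_mul_swap_subset (col σ : Fin n → β) (D : Finset (Fin n))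
    (π₀ : Equiv.Perm (Fin n)) (a k : Fin n) (hk : k ∈ insert a D) :
    rearrangements col σ D (π₀ * Equiv.swap a k) ⊆ rearrangements col σ (insert a D) π₀ := by
  intro π hπ
  rw [mem_rearrangements] at hπ ⊢
  refine ⟨fun j hj => ?_, hπ.2⟩
  have hjk : j ≠ k := fun h => hj (h ▸ hk)
  rw [mem_insert, not_or] at hj
  rw [hπ.1 j hj.2, Equiv.Perm.mul_apply, Equiv.swap_apply_of_ne_of_ne hj.1 hjk]

lemma apply_of_mem_rearrangements_mul_swap {col σ : Fin n → β} {D : Finset (Fin n)}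
    {π₀ π : Equiv.Perm (Fin n)} {a k : Fin n} (ha : a ∉ D)
    (hπ : π ∈ rearrangements col σ D (π₀ * Equiv.swap a k)) : π a = π₀ k := by
  rw [(mem_rearrangements.1 hπ).1 a ha, Equiv.Perm.mul_apply, Equiv.swap_apply_left]

/-- The number of inversions, with respect to the key `K` on rows, between columns of `D` of the
same colour. -/
def inversions (col : Fin n → β) (K : Fin n → ℕ) (D : Finset (Fin n)) (π : Equiv.Perm (Fin n)) :
    ℕ :=
  ∑ j ∈ D, #{k ∈ D | j < k ∧ col k = col j ∧ K (π k) < K (π j)}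

/-- The rearrangements are sorted by the column `k` from which `a` takes its row. After composing
`π₀` with the swap of `a` and `k`, only the columns of `D` remain to be rearranged. -/
lemma sum_rearrangements_insert {M : Type*} [AddCommMonoid M] (col σ : Fin n → β)
    (D : Finset (Fin n)) (π₀ : Equiv.Perm (Fin n)) (h₀ : ∀ j, σ (π₀ j) = col j) (a : Fin n)
    (ha : a ∉ D) (g : Equiv.Perm (Fin n) → M) :
    ∑ π ∈ rearrangements col σ (insert a D) π₀, g π =
      ∑ k ∈ insert a D with col k = col a,
        ∑ π ∈ rearrangements col σ D (π₀ * Equiv.swap a k), g π := by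
  rw [← sum_fiberwise_of_maps_to (s := rearrangements col σ (insert a D) π₀)
    (t := {k ∈ insert a D | col k = col a}) (g := fun π => π₀.symm (π a))]
  · refine sum_congr rfl fun k hk => sum_congr ?_ fun _ _ => rfl
    simp only [mem_filter] at hk
    ext π
    rw [mem_filter, Equiv.symm_apply_eq]
    refine ⟨fun h => ?_, fun h => ⟨rearrangements_mul_swap_subset col σ D π₀ a k hk.1 h,
      apply_of_mem_rearrangements_mul_swap ha h⟩⟩
    rw [mem_rearrangements] at h ⊢
    refine ⟨fun j hj => ?_, h.1.2⟩
    rw [Equiv.Perm.mul_apply]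
    by_cases hja : j = a
    · rw [hja, Equiv.swap_apply_left, h.2]
    · have hj' : j ∉ insert a D := by simp [hja, hj]
      rw [Equiv.swap_apply_of_ne_of_ne hja fun h => hj' (h ▸ hk.1), h.1.1 j hj']
  · intro π hπ
    rw [mem_rearrangements] at hπ
    rw [mem_filter]
    constructor
    · by_contra h
      have := hπ.1 _ h
      rw [Equiv.apply_symm_apply] at this
      rw [← π.injective this] at h
      simp at h
      exact h.1 (π.injective this)
    · rw [← hπ.2 a, ← h₀, Equiv.apply_symm_apply]

/-- A rearrangement fills the columns of `D` with the same rows as `π₀`, and the colour of a column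
is that of its row, so both sides count the same rows. Thus the inversions of the leftmost column
are known before the others are filled. -/
lemma card_filter_rearrangement (col σ : Fin n → β) (K : Fin n → ℕ) (D : Finset (Fin n))
    (π₀ π : Equiv.Perm (Fin n)) (h₀ : ∀ j, σ (π₀ j) = col j)
    (hπ : π ∈ rearrangements col σ D π₀) (b : β) (m : ℕ) :
    #{k ∈ D | col k = b ∧ K (π k) < m} = #{k ∈ D | col k = b ∧ K (π₀ k) < m} := by
  rw [mem_rearrangements] at hπ
  have hD : ∀ r, π.symm r ∈ D ↔ π₀.symm r ∈ D := by
    intro r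
    rw [← not_iff_not]
    constructor
    · intro h
      have := hπ.1 _ h
      rw [Equiv.apply_symm_apply] at this
      have h' : π₀.symm r = π.symm r := by rw [Equiv.symm_apply_eq]; exact this
      rwa [h']
    · intro h
      have := hπ.1 _ h
      rw [Equiv.apply_symm_apply] at this
      have h' : π.symm r = π₀.symm r := by rw [Equiv.symm_apply_eq]; exact this.symm
      rwa [h']
  rw [← card_map π.toEmbedding, ← card_map π₀.toEmbedding (s := {k ∈ D | col k = b ∧ K (π₀ k) < m})]
  congr 1
  ext r
  have e1 : col (π.symm r) = σ r := by rw [← hπ.2, Equiv.apply_symm_apply]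
  have e2 : col (π₀.symm r) = σ r := by rw [← h₀, Equiv.apply_symm_apply]
  simp only [mem_map_equiv, mem_filter, Equiv.apply_symm_apply, hD, e1, e2]

lemma inversions_insert (col : Fin n → β) (K : Fin n → ℕ) (D : Finset (Fin n)) (a : Fin n)
    (ha : ∀ k ∈ D, a < k) (π : Equiv.Perm (Fin n)) :
    inversions col K (insert a D) π =
      #{k ∈ insert a D | col k = col a ∧ K (π k) < K (π a)} + inversions col K D π := by
  have haD : a ∉ D := fun h => lt_irrefl _ (ha a h)
  rw [inversions, sum_insert haD, inversions]
  congr 1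
  · congr 1
    ext k
    simp only [mem_filter, mem_insert]
    constructor
    · tauto
    · rintro ⟨rfl | h, h1, h2⟩
      · exact absurd h2 (lt_irrefl _)
      · exact ⟨Or.inr h, ha k h, h1, h2⟩
  · refine sum_congr rfl fun j hj => ?_
    rw [filter_insert, if_neg]
    exact fun h => (ha j hj).not_gt h.1

/-- Filling the leftmost column `a` with the candidate row of rank `m` within its colour creates `m`
inversions there, whatever follows. By `sum_rank` this column contributes the `q`-number of the size
of its colour class, and the rest is induction. -/
theorem sum_inversions (col σ : Fin n → β) (K : Fin n → ℕ)
    (hK : ∀ r s, σ r = σ s → K r = K s → r = s) (D : Finset (Fin n)) :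
    ∀ π₀ : Equiv.Perm (Fin n), (∀ j, σ (π₀ j) = col j) →
      ∑ π ∈ rearrangements col σ D π₀, q ^ (inversions col K D π : ℤ) =
        ∏ j ∈ D, qNumber #{k ∈ D | col k = col j ∧ j ≤ k} := by
  induction D using Finset.induction_on_min with
  | empty =>
    intro π₀ h₀
    have : rearrangements col σ ∅ π₀ = {π₀} := by
      ext π
      simp only [mem_rearrangements, notMem_empty, not_false_eq_true, forall_const, mem_singleton]
      exact ⟨fun h => Equiv.ext h.1, by rintro rfl; exact ⟨fun _ => rfl, h₀⟩⟩
    simp [this, inversions]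
  | insert a D ha ih =>
    intro π₀ h₀
    have haD : a ∉ D := fun h => lt_irrefl _ (ha a h)
    have hinj : Set.InjOn (fun k => K (π₀ k))
        (({k ∈ insert a D | col k = col a} : Finset (Fin n)) : Set (Fin n)) := by
      intro k hk l hl h
      rw [mem_coe, mem_filter] at hk hl
      exact π₀.injective (hK _ _ (by rw [h₀, h₀, hk.2, hl.2]) h)
    rw [prod_insert haD, sum_rearrangements_insert col σ D π₀ h₀ a haD]
    have h1 : {k ∈ insert a D | col k = col a ∧ a ≤ k} = {k ∈ insert a D | col k = col a} := by
      refine filter_congr fun k hk => and_iff_left ?_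
      rcases mem_insert.1 hk with rfl | hk
      exacts [le_rfl, (ha k hk).le]
    have h2 : ∀ j ∈ D, qNumber #{k ∈ insert a D | col k = col j ∧ j ≤ k} =
        qNumber #{k ∈ D | col k = col j ∧ j ≤ k} := by
      intro j hj
      rw [filter_insert, if_neg]
      exact fun h => (ha j hj).not_ge h.2
    rw [h1, prod_congr rfl h2, ← sum_rank _ _ hinj, sum_mul]
    refine sum_congr rfl fun k hk => ?_
    rw [mem_filter] at hk
    have hsw := color_mul_swap col σ π₀ h₀ a k hk.2
    rw [← ih _ hsw, mul_sum]
    refine sum_congr rfl fun π hπ => ?_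
    have hπ' := rearrangements_mul_swap_subset col σ D π₀ a k hk.1 hπ
    have hπa := apply_of_mem_rearrangements_mul_swap haD hπ
    rw [inversions_insert col K D a ha, Nat.cast_add, zpow_add₀ q_ne_zero,
      card_filter_rearrangement col σ K _ π₀ π h₀ hπ', hπa, filter_filter]

/-- Greedy choice: the leftmost column receives the row of least key of its colour. -/
theorem exists_inversions_eq_zero (col σ : Fin n → β) (K : Fin n → ℕ) (D : Finset (Fin n)) :
    ∀ π₀ : Equiv.Perm (Fin n), (∀ j, σ (π₀ j) = col j) →
      ∃ π ∈ rearrangements col σ D π₀, inversions col K D π = 0 := by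
  induction D using Finset.induction_on_min with
  | empty =>
    intro π₀ h₀
    exact ⟨π₀, by simp [rearrangements, h₀], by simp [inversions]⟩
  | insert a D ha ih =>
    intro π₀ h₀
    have haD : a ∉ D := fun h => lt_irrefl _ (ha a h)
    obtain ⟨k, hk, hmin⟩ := exists_min_image {k ∈ insert a D | col k = col a}
      (fun k => K (π₀ k)) ⟨a, by simp⟩
    rw [mem_filter] at hk
    obtain ⟨π, hπ, hinv⟩ := ih _ (color_mul_swap col σ π₀ h₀ a k hk.2)
    have hπ' := rearrangements_mul_swap_subset col σ D π₀ a k hk.1 hπ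
    have hπa := apply_of_mem_rearrangements_mul_swap haD hπ
    refine ⟨π, hπ', ?_⟩
    rw [inversions_insert col K D a ha, hinv, add_zero,
      card_filter_rearrangement col σ K _ π₀ π h₀ hπ', hπa, card_eq_zero, filter_eq_empty_iff]
    rintro l hl ⟨h1, h2⟩
    exact (hmin l (mem_filter.2 ⟨hl, h1⟩)).not_gt h2

theorem eq_of_inversions_eq_zero (col σ : Fin n → β) (K : Fin n → ℕ)
    (hK : ∀ r s, σ r = σ s → K r = K s → r = s) (π π' : Equiv.Perm (Fin n))
    (hπ : ∀ j, σ (π j) = col j) (hπ' : ∀ j, σ (π' j) = col j)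
    (h : inversions col K univ π = 0) (h' : inversions col K univ π' = 0) : π = π' := by
  have key : ∀ ρ : Equiv.Perm (Fin n), inversions col K univ ρ = 0 → ∀ j k, j < k →
      col k = col j → K (ρ j) ≤ K (ρ k) := by
    intro ρ hρ j k hjk hc
    rw [inversions, sum_eq_zero_iff] at hρ
    have := hρ j (mem_univ _)
    rw [card_eq_zero, filter_eq_empty_iff] at this
    have := this (mem_univ k)
    by_contra hlt
    exact this ⟨hjk, hc, not_le.1 hlt⟩
  -- If `ρ` and `ρ'` agree to the left of `j`, then `ρ'` has the row `ρ j` in column `j` or further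
  -- right, in a column of the same colour; since `ρ'` has no inversions, its row in column `j` has
  -- no larger key.
  have aux : ∀ ρ ρ' : Equiv.Perm (Fin n), (∀ j, σ (ρ j) = col j) → (∀ j, σ (ρ' j) = col j) →
      inversions col K univ ρ' = 0 → ∀ j, (∀ k < j, ρ k = ρ' k) → K (ρ' j) ≤ K (ρ j) := by
    intro ρ ρ' h1 h2 h3 j hj
    obtain ⟨k, hk⟩ := ρ'.surjective (ρ j)
    rw [← hk]
    rcases lt_trichotomy k j with hlt | rfl | hlt
    · exact absurd (ρ.injective ((hj k hlt).trans hk)) hlt.ne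
    · exact le_rfl
    · exact key ρ' h3 j k hlt (by rw [← h2, hk, h1])
  refine Equiv.ext fun j => ?_
  induction j using WellFoundedLT.induction with
  | ind j ih =>
    exact hK _ _ (by rw [hπ, hπ']) (le_antisymm
      (aux π' π hπ' hπ h j fun k hk => (ih k hk).symm) (aux π π' hπ hπ' h' j ih))

/-- The cardinalities run through `#S, …, 2, 1`. -/
lemma prod_qNumber_card (S : Finset (Fin n)) :
    ∏ j ∈ S, qNumber #{k ∈ S | j ≤ k} = qFactorial #S := by
  induction S using Finset.induction_on_min with
  | empty => simp [qFactorial_zero]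
  | insert a S ha ih =>
    have haS : a ∉ S := fun h => lt_irrefl _ (ha a h)
    rw [prod_insert haS, card_insert_of_notMem haS, qFactorial_succ, ← ih]
    congr 1
    · rw [filter_true_of_mem, card_insert_of_notMem haS]
      intro k hk
      rcases mem_insert.1 hk with rfl | hk
      exacts [le_rfl, (ha k hk).le]
    · refine prod_congr rfl fun j hj => ?_
      rw [filter_insert, if_neg (ha j hj).not_ge]

lemma prod_qNumber_fiber [Fintype β] (col : Fin n → β) :
    ∏ j : Fin n, qNumber #{k : Fin n | col k = col j ∧ j ≤ k} =
      ∏ b, qFactorial #{j : Fin n | col j = b} := by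
  rw [← prod_fiberwise (M := RatFunc ℚ) univ col]
  refine prod_congr rfl fun b _ => ?_
  rw [← prod_qNumber_card]
  refine prod_congr rfl fun j hj => ?_
  rw [filter_filter, (mem_filter.1 hj).2]

end

/-! ### Decompositions of `mat` by squares, by columns and by pairs of rooks. -/

section

variable {n : ℕ}

/-- The contribution of the square `(i, j)` to `mat`, when `B` has height `h` in column `j` and
the rook of that column is in row `r`. -/
def cellWeight (C : Equiv.Perm (Fin n)) (h : ℕ) (r i j : Fin n) : ℤ :=
  if (r : ℕ) < h then
    (if r < i ∧ (i : ℕ) < h ∧ j < C i then 1 else 0) - (if h ≤ (i : ℕ) ∧ C i < j then 1 else 0)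
  else (if (i : ℕ) < h then 1 else 0) + (if h ≤ (i : ℕ) ∧ i < r ∧ j < C i then 1 else 0)

/-- The term `n(n-k)` counts the squares in the columns whose rook is off `B`, so each term of `mat`
is a sum over squares and the identity is checked square by square. -/
lemma mat_eq_sum_cellWeight (B : Finset (Fin n × Fin n)) (H : Fin n → ℕ)
    (hB : ∀ i j, (i, j) ∈ B ↔ (i : ℕ) < H j) (C : Equiv.Perm (Fin n)) :
    mat C B = ∑ j, ∑ i, cellWeight C (H j) (C.symm j) i j := by
  have h1 : (n : ℤ) * ((n : ℤ) - hits C B) =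
      ∑ j, ∑ _i : Fin n, if (C.symm j : ℕ) < H j then (0 : ℤ) else 1 := by
    have e : (hits C B : ℤ) = ∑ j, if (C.symm j : ℕ) < H j then (1 : ℤ) else 0 := by
      rw [hits, ← sum_boole, ← Equiv.sum_comp C fun j => if (C.symm j : ℕ) < H j then (1 : ℤ) else 0]
      simp only [hB, Equiv.symm_apply_apply]
    have e' : ((n : ℤ) - hits C B) = ∑ j, if (C.symm j : ℕ) < H j then (0 : ℤ) else 1 := by
      have : (n : ℤ) = ∑ _j : Fin n, 1 := by simp
      rw [e, this, ← sum_sub_distrib]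
      refine sum_congr rfl fun j _ => ?_
      split_ifs <;> rfl
    rw [e', mul_sum]
    simp
  have h2 : (#B : ℤ) = ∑ j, ∑ i : Fin n, if (i : ℕ) < H j then (1 : ℤ) else 0 := by
    have : B = univ.filter fun s : Fin n × Fin n => (s.1 : ℕ) < H s.2 := by
      ext ⟨i, j⟩
      simp [hB]
    rw [this, ← sum_boole, Fintype.sum_prod_type_right]
  have h3 : (cross C B : ℤ) = ∑ j, ∑ i, if (C i ≤ j ∨ (i < C.symm j ∧ (i : ℕ) < H j) ∨
      (C.symm j < i ∧ ¬ (C.symm j : ℕ) < H j)) then (1 : ℤ) else 0 := by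
    rw [cross, ← sum_boole, Fintype.sum_prod_type_right]
    simp only [hB]
  rw [mat, h1, h2, h3, ← sum_add_distrib, ← sum_sub_distrib]
  refine sum_congr rfl fun j _ => ?_
  rw [← sum_add_distrib, ← sum_sub_distrib]
  refine sum_congr rfl fun i _ => ?_
  obtain ⟨r, rfl⟩ := C.surjective j
  rw [Equiv.symm_apply_apply]
  have hir : C i = C r ↔ i = r := C.injective.eq_iff
  simp only [cellWeight, Fin.lt_def, Fin.le_def, Fin.ext_iff] at hir ⊢
  generalize (C i : ℕ) = x at *
  generalize (C r : ℕ) = y at *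
  generalize H (C r) = h at *
  split_ifs <;> omega

lemma mat_eq_sum_colWeight (B : Finset (Fin n × Fin n)) (H : Fin n → ℕ)
    (hB : ∀ i j, (i, j) ∈ B ↔ (i : ℕ) < H j) (hH : ∀ j, H j ≤ n) (C : Equiv.Perm (Fin n)) :
    mat C B = ∑ j, colWeight (H j) {i | C i < j} (C.symm j) := by
  rw [mat_eq_sum_cellWeight B H hB]
  refine sum_congr rfl fun j _ => ?_
  obtain ⟨r, rfl⟩ := C.surjective j
  have hcard : (H (C r) : ℤ) = ∑ i : Fin n, if (i : ℕ) < H (C r) then 1 else 0 := by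
    rw [sum_boole, Fin.card_filter_val_lt]
    simp [hH]
  rw [Equiv.symm_apply_apply]
  unfold colWeight cellWeight
  split_ifs
  · rw [sum_sub_distrib, sum_boole, sum_boole]
    congr 3
    all_goals
      ext i
      have hir : C i = C r ↔ i = r := C.injective.eq_iff
      simp only [mem_filter, mem_univ, true_and, Fin.lt_def, Fin.ext_iff] at hir ⊢
      omega
  · rw [sum_add_distrib, ← hcard, sum_boole]
    congr 3
    ext i
    have hir : C i = C r ↔ i = r := C.injective.eq_iff
    simp only [mem_filter, mem_univ, true_and, Fin.lt_def, Fin.ext_iff] at hir ⊢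
    omega

/-- The joint contribution to `mat` of a rook in row `r` and a column of height `a` and a rook in
row `s` and a column further right of height `b`. -/
def pairWeight (a b r s : ℕ) : ℤ :=
  (if r < a then (if r < s ∧ s < a then 1 else 0) else if a ≤ s ∧ s < r then 1 else 0) -
    if s < b ∧ b ≤ r then 1 else 0

/-- The square in row `i` and column `j` is charged to the pair formed by the rook of row `i` and
the rook of column `j`. The unpaired term is the area of a column whose rook is off `B`. -/
lemma mat_eq_sum_pairWeight (B : Finset (Fin n × Fin n)) (H : Fin n → ℕ)
    (hB : ∀ i j, (i, j) ∈ B ↔ (i : ℕ) < H j) (hH : ∀ j, H j ≤ n) (C : Equiv.Perm (Fin n)) :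
    mat C B = ∑ i : Fin n, (if (i : ℕ) < H (C i) then (0 : ℤ) else H (C i)) +
      ∑ i : Fin n, ∑ k : Fin n,
        if C i < C k then pairWeight (H (C i)) (H (C k)) i k else 0 := by
  have hcard : ∀ i : Fin n, (if (i : ℕ) < H (C i) then (0 : ℤ) else H (C i)) =
      ∑ k : Fin n, if (i : ℕ) < H (C i) then (0 : ℤ) else if (k : ℕ) < H (C i) then 1 else 0 := by
    intro i
    split_ifs
    · simp
    · rw [sum_boole, Fin.card_filter_val_lt]
      simp [hH]
  have h1 : ∑ i : Fin n, ∑ k : Fin n,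
      (if C i < C k then pairWeight (H (C i)) (H (C k)) i k else 0) =
      ∑ i : Fin n, ∑ k : Fin n, (if C i < C k then
        (if (i : ℕ) < H (C i) then (if (i : ℕ) < k ∧ (k : ℕ) < H (C i) then (1 : ℤ) else 0) else
          if H (C i) ≤ k ∧ (k : ℕ) < i then 1 else 0) else 0) -
      ∑ i : Fin n, ∑ k : Fin n, (if C k < C i ∧ (i : ℕ) < H (C i) ∧ H (C i) ≤ k then 1 else 0) := by
    conv_rhs => rw [sum_comm (f := fun i k : Fin n =>
      if C k < C i ∧ (i : ℕ) < H (C i) ∧ H (C i) ≤ k then (1 : ℤ) else 0)]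
    rw [← sum_sub_distrib]
    refine sum_congr rfl fun i _ => ?_
    rw [← sum_sub_distrib]
    refine sum_congr rfl fun k _ => ?_
    unfold pairWeight
    by_cases h : C i < C k <;> simp [h]
  rw [mat_eq_sum_cellWeight B H hB, ← Equiv.sum_comp C, h1, sum_congr rfl fun i _ => hcard i,
    ← sum_sub_distrib, ← sum_add_distrib]
  refine sum_congr rfl fun i _ => ?_
  rw [← sum_sub_distrib, ← sum_add_distrib]
  refine sum_congr rfl fun k _ => ?_
  rw [Equiv.symm_apply_apply]
  simp only [cellWeight, Fin.lt_def]
  generalize (C i : ℕ) = x at *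
  generalize (C k : ℕ) = y at *
  generalize H (C i) = h at *
  split_ifs <;> omega

/-- The order of the rows in a section of height `h` in which the rooks of a standard placement
are arranged: first the rows off the board, from top to bottom, then the rows on the board, from
bottom to top. -/
def rowKey (n h i : ℕ) : ℕ := if i < h then 2 * n - i else i

lemma rowKey_injective {h : ℕ} {i k : Fin n} (e : rowKey n h i = rowKey n h k) : i = k := by
  have := i.2
  have := k.2
  refine Fin.ext ?_
  unfold rowKey at e
  split_ifs at e <;> omega

/-- The subtracted indicator, that one row is on the board and the other off it, is symmetric in `r`
and `s`. Hence exchanging the order of two rooks of a class affects only the inversion. -/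
lemma pairWeight_self (a : ℕ) (r s : Fin n) (hrs : r ≠ s) :
    pairWeight a a r s = (if rowKey n a s < rowKey n a r then 1 else 0) -
      if ((r : ℕ) < a ↔ (s : ℕ) < a) then 0 else 1 := by
  have := r.2
  have := s.2
  have h : (r : ℕ) ≠ s := fun h => hrs (Fin.ext h)
  unfold pairWeight rowKey
  split_ifs <;> omega

lemma sum_sum_congr_of_symm {α : Type*} [Fintype α] (F G : α → α → ℤ)
    (h : ∀ i k, F i k + F k i = G i k + G k i) : ∑ i, ∑ k, F i k = ∑ i, ∑ k, G i k := by
  have key : ∀ E : α → α → ℤ, ∑ i, ∑ k, (E i k + E k i) = 2 * ∑ i, ∑ k, E i k := by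
    intro E
    simp only [sum_add_distrib]
    rw [sum_comm (f := fun i k => E k i)]
    ring
  have := key F
  simp only [h, key G] at this
  linarith

lemma inversions_symm_eq_sum {β : Type*} [DecidableEq β] (col : Fin n → β) (K : Fin n → ℕ)
    (C : Equiv.Perm (Fin n)) :
    (inversions col K univ C.symm : ℤ) = ∑ i, ∑ k,
      if C i < C k then (if col (C k) = col (C i) ∧ K k < K i then 1 else 0) else 0 := by
  rw [inversions, Nat.cast_sum, ← Equiv.sum_comp C]
  refine sum_congr rfl fun i _ => ?_
  rw [← sum_boole, ← Equiv.sum_comp C]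
  refine sum_congr rfl fun k _ => ?_
  simp only [Equiv.symm_apply_apply]
  split_ifs <;> tauto

/-- When the placements of a class are those that match a colouring of the rows with a colouring
of the columns by intervals of constant height, `mat` counts inversions, up to a constant. -/
theorem mat_sub_inversions {β : Type*} [DecidableEq β] (B : Finset (Fin n × Fin n))
    (H : Fin n → ℕ) (hB : ∀ i j, (i, j) ∈ B ↔ (i : ℕ) < H j) (hH : ∀ j, H j ≤ n)
    (col : Fin n → β) (hcol : ∀ j k, col j = col k → H j = H k)
    (hconv : ∀ j k l, j ≤ k → k ≤ l → col j = col l → col k = col j)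
    (C C' : Equiv.Perm (Fin n)) (hC : ∀ i, col (C i) = col (C' i)) (K : Fin n → ℕ)
    (hK : ∀ i, K i = rowKey n (H (C i)) i) :
    mat C B - inversions col K univ C.symm = mat C' B - inversions col K univ C'.symm := by
  have hHC : ∀ i, H (C' i) = H (C i) := fun i => (hcol _ _ (hC i)).symm
  rw [mat_eq_sum_pairWeight B H hB hH, mat_eq_sum_pairWeight B H hB hH, inversions_symm_eq_sum,
    inversions_symm_eq_sum]
  simp only [hHC, ← hC, add_sub_assoc, ← sum_sub_distrib]
  congr 1
  -- A rearrangement may move the contribution of a pair of rooks from `(i, k)` to `(k, i)`, so only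
  -- symmetrized terms can be compared.
  refine sum_sum_congr_of_symm _ _ fun i k => ?_
  by_cases hik : i = k
  · subst hik
    simp
  by_cases hc : col (C i) = col (C k)
  · have h1 : C i < C k ∨ C k < C i := lt_or_gt_of_ne fun h => hik (C.injective h)
    have h2 : C' i < C' k ∨ C' k < C' i := lt_or_gt_of_ne fun h => hik (C'.injective h)
    have e1 := pairWeight_self (H (C i)) i k hik
    have e2 := pairWeight_self (H (C i)) k i (Ne.symm hik)
    have e3 : (if ((i : ℕ) < H (C i) ↔ (k : ℕ) < H (C i)) then (0 : ℤ) else 1) =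
        if ((k : ℕ) < H (C i) ↔ (i : ℕ) < H (C i)) then 0 else 1 := by simp only [iff_comm]
    rw [hK i, hK k, ← hcol _ _ hc, e1, e2]
    simp only [hc, true_and, e3]
    rcases h1 with h1 | h1 <;> rcases h2 with h2 | h2 <;> simp [h1, h2, h1.not_gt, h2.not_gt]
  -- Colour classes are intervals, so the left-right order of two columns of different colours
  -- depends on the colours alone.
  · have hord : ∀ x y : Fin n, col (C x) ≠ col (C y) → C x < C y → C' x < C' y := by
      intro x y hxy hlt
      by_contra hge
      rw [not_lt] at hge
      rcases le_total (C y) (C' x) with h | h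
      · exact hxy (hconv _ _ _ hlt.le h (hC x)).symm
      · exact hxy ((hC x).trans ((hconv _ _ _ hge h (hC y).symm).trans (hC y).symm))
    have e1 : C i < C k ↔ C' i < C' k := ⟨hord i k hc, fun h => by
      by_contra h'
      have := hord k i (Ne.symm hc) (lt_of_le_of_ne (not_lt.1 h') fun e => hik (C.injective e).symm)
      exact h.not_gt this⟩
    have e2 : C k < C i ↔ C' k < C' i := ⟨hord k i (Ne.symm hc), fun h => by
      by_contra h'
      have := hord i k hc (lt_of_le_of_ne (not_lt.1 h') fun e => hik (C.injective e))
      exact h.not_gt this⟩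
    simp only [e1, e2]

end

/-! ### The sum over all placements. -/

section

variable {n : ℕ}

/-- Unrolls the recursion `columnSum`: with a single colour, the rearrangements of the columns from
`w` on are all ways to fill them with the rows that `π₀` does not use in the first `w` columns. -/
lemma sum_rearrangements_eq_columnSum (H : Fin n → ℕ) (m : ℕ) :
    ∀ w, w + m = n → ∀ π₀ : Equiv.Perm (Fin n),
      ∑ π ∈ rearrangements (fun _ => ()) (fun _ => ()) {k : Fin n | w ≤ (k : ℕ)} π₀,
        q ^ (∑ j ∈ univ.filter fun j : Fin n => w ≤ (j : ℕ), colWeight (H j) {i | π.symm i < j} (π j)) =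
      columnSum ((List.ofFn H).drop w) {i | (π₀.symm i : ℕ) < w} := by
  induction m with
  | zero =>
    intro w hw π₀
    obtain rfl : w = n := hw
    have hD : (univ.filter fun k : Fin w => w ≤ (k : ℕ)) = ∅ :=
      filter_eq_empty_iff.2 fun k _ => k.2.not_ge
    have : rearrangements (fun _ => ()) (fun _ => ()) (∅ : Finset (Fin w)) π₀ = {π₀} := by
      ext π
      simp only [mem_rearrangements, notMem_empty, not_false_eq_true, forall_const, mem_singleton,
        implies_true, and_true]
      exact ⟨Equiv.ext, by rintro rfl _; rfl⟩
    rw [hD, this, List.drop_of_length_le (by simp)]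
    simp [columnSum]
  | succ m ih =>
    intro w hw π₀
    have hwn : w < n := by omega
    set a : Fin n := ⟨w, hwn⟩ with ha
    have hD : (univ.filter fun k : Fin n => w ≤ (k : ℕ)) =
        insert a (univ.filter fun k : Fin n => w + 1 ≤ (k : ℕ)) := by
      ext k
      simp only [mem_filter, mem_univ, true_and, mem_insert, Fin.ext_iff, ha]
      omega
    have haD : a ∉ (univ.filter fun k : Fin n => w + 1 ≤ (k : ℕ)) := by simp [ha]
    have hL : (List.ofFn H).drop w = H a :: (List.ofFn H).drop (w + 1) := by
      rw [List.drop_eq_getElem_cons (by simpa using hwn)]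
      simp [ha]
    have hU : (univ.filter fun i : Fin n => (π₀.symm i : ℕ) < w)ᶜ =
        (univ.filter fun k : Fin n => w ≤ (k : ℕ)).map π₀.toEmbedding := by
      ext i
      simp [mem_map_equiv]
    rw [hL, columnSum, hU, sum_map, hD,
      sum_rearrangements_insert (fun _ => ()) (fun _ => ()) _ π₀ (fun _ => rfl) a haD,
      filter_true_of_mem fun _ _ => rfl]
    refine sum_congr rfl fun k hk => ?_
    have hUk : (univ.filter fun i : Fin n => ((π₀ * Equiv.swap a k).symm i : ℕ) < w + 1) =
        insert (π₀ k) (univ.filter fun i : Fin n => (π₀.symm i : ℕ) < w) := by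
      ext i
      obtain ⟨j, rfl⟩ := π₀.surjective i
      have hkw : w ≤ (k : ℕ) := by
        rw [← hD] at hk
        simpa using hk
      have e : (π₀ * Equiv.swap a k).symm (π₀ j) = Equiv.swap a k j := by
        rw [Equiv.symm_apply_eq, Equiv.Perm.mul_apply, Equiv.swap_apply_self]
      rw [mem_filter, e, mem_insert, mem_filter, Equiv.symm_apply_apply, π₀.injective.eq_iff,
        Equiv.swap_apply_def]
      simp only [mem_univ, true_and, ha, Fin.ext_iff]
      split_ifs with h1 h2 <;> simp only [ha] at * <;> omega
    rw [Equiv.coe_toEmbedding, ← hUk, ← ih (w + 1) (by omega), mul_sum]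
    refine sum_congr rfl fun π hπ => ?_
    have hπa := apply_of_mem_rearrangements_mul_swap haD hπ
    have hπ' := rearrangements_mul_swap_subset _ _ _ π₀ a k hk hπ
    rw [← hD, mem_rearrangements] at hπ'
    have hlt : ∀ j : Fin n, (j : ℕ) < w → π j = π₀ j := fun j hj => hπ'.1 j (by simpa using hj)
    have hset : (univ.filter fun i : Fin n => π.symm i < a) =
        univ.filter fun i : Fin n => (π₀.symm i : ℕ) < w := by
      refine filter_congr fun i _ => ⟨fun h => ?_, fun h => ?_⟩
      · have := hlt _ h
        rw [Equiv.apply_symm_apply] at this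
        rw [show π₀.symm i = π.symm i by rw [Equiv.symm_apply_eq]; exact this]
        exact h
      · have := hlt _ h
        rw [Equiv.apply_symm_apply] at this
        rw [show π.symm i = π₀.symm i by rw [Equiv.symm_apply_eq]; exact this.symm]
        exact h
    rw [sum_insert haD, zpow_add₀ q_ne_zero, hπa, hset]

/-- On a board with nondecreasing column heights, `mat` is Mahonian. -/
theorem sum_mat (B : Finset (Fin n × Fin n)) (H : Fin n → ℕ)
    (hB : ∀ i j, (i, j) ∈ B ↔ (i : ℕ) < H j) (hH : ∀ j, H j ≤ n) (hmono : Monotone H) :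
    ∑ C : Equiv.Perm (Fin n), q ^ mat C B = qFactorial n := by
  have hlen : (List.ofFn H).length = n := by simp
  rw [← columnSum_empty (List.ofFn H) (List.pairwise_ofFn.2 fun _ _ h => hmono h.le)
    (by simpa [List.mem_ofFn] using hH) hlen]
  have := sum_rearrangements_eq_columnSum H n 0 (zero_add n) 1
  simp only [zero_le, filter_true, not_lt_zero, filter_false, List.drop_zero] at this
  rw [← this]
  have huniv : rearrangements (fun _ : Fin n => ()) (fun _ => ()) univ 1 = univ := by
    ext π
    simp [mem_rearrangements]
  rw [huniv]
  refine Fintype.sum_equiv (Equiv.inv _) _ _ fun C => ?_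
  rw [mat_eq_sum_colWeight B H hB hH]
  rfl

/-! ### Sorted and standard placements. -/

/-- In each colour class of columns, the rooks of `C` are arranged in the order given by
`rowKey`. -/
def IsSorted {β : Type*} (H : Fin n → ℕ) (col : Fin n → β) (C : Equiv.Perm (Fin n)) : Prop :=
  ∀ i k, col (C i) = col (C k) → rowKey n (H (C i)) i < rowKey n (H (C k)) k → C i < C k

lemma isSorted_iff {β : Type*} [DecidableEq β] (H : Fin n → ℕ) (col : Fin n → β)
    (C : Equiv.Perm (Fin n)) (K : Fin n → ℕ) (hK : ∀ i, K i = rowKey n (H (C i)) i) :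
    IsSorted H col C ↔ inversions col K univ C.symm = 0 := by
  simp only [inversions, sum_eq_zero_iff, card_eq_zero, filter_eq_empty_iff, mem_univ,
    forall_const, IsSorted]
  constructor
  · intro h j k
    rintro ⟨h1, h2, h3⟩
    have := h (C.symm k) (C.symm j) (by simpa using h2) (by rw [← hK, ← hK]; exact h3)
    simp only [Equiv.apply_symm_apply] at this
    exact h1.not_gt this
  · intro h i k hc hlt
    rw [← hK, ← hK] at hlt
    have := @h (C k) (C i)
    simp only [Equiv.symm_apply_apply] at this
    by_contra hge
    refine this ⟨lt_of_le_of_ne (not_lt.1 hge) fun e => ?_, hc, hlt⟩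
    rw [C.injective e] at hlt
    exact lt_irrefl _ hlt

/-- The common source of (a) and (c). By `mat_sub_inversions`, `mat` exceeds its value at the
inversion-free placement by exactly the number of inversions. -/
theorem exists_isSorted {β : Type*} [DecidableEq β] [Fintype β] (B : Finset (Fin n × Fin n))
    (H : Fin n → ℕ) (hB : ∀ i j, (i, j) ∈ B ↔ (i : ℕ) < H j) (hH : ∀ j, H j ≤ n)
    (col : Fin n → β) (hcol : ∀ j k, col j = col k → H j = H k)
    (hconv : ∀ j k l, j ≤ k → k ≤ l → col j = col l → col k = col j)
    (σ : Fin n → β) (C₀ : Equiv.Perm (Fin n)) (h₀ : ∀ i, col (C₀ i) = σ i) :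
    ∃ E : Equiv.Perm (Fin n), (∀ i, col (E i) = σ i) ∧ IsSorted H col E ∧
      (∀ C : Equiv.Perm (Fin n), (∀ i, col (C i) = σ i) → IsSorted H col C → C = E) ∧
      (∀ C : Equiv.Perm (Fin n), (∀ i, col (C i) = σ i) → mat E B ≤ mat C B) ∧
      ∑ C : Equiv.Perm (Fin n) with ∀ i, col (C i) = σ i, q ^ mat C B =
        q ^ mat E B * ∏ b, qFactorial #{j | col j = b} := by
  -- The colour of a rook's column determines its height, so this key depends on `σ` only and is the
  -- same for every placement of the class.
  set K : Fin n → ℕ := fun i => rowKey n (H (C₀ i)) i with hKdef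
  have hKC : ∀ C : Equiv.Perm (Fin n), (∀ i, col (C i) = σ i) →
      ∀ i, K i = rowKey n (H (C i)) i := fun C hC i => by
    rw [hKdef]
    simp only
    rw [hcol (C₀ i) (C i) (by rw [h₀, hC])]
  have hK : ∀ r s, σ r = σ s → K r = K s → r = s := fun r s h e => by
    simp only [hKdef] at e
    rw [hcol (C₀ r) (C₀ s) (by rw [h₀, h₀, h])] at e
    exact rowKey_injective e
  have hsymm : ∀ C : Equiv.Perm (Fin n), (∀ i, col (C i) = σ i) ↔ ∀ j, σ (C.symm j) = col j :=
    fun C => ⟨fun h j => by rw [← h, Equiv.apply_symm_apply],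
      fun h i => by rw [← h, Equiv.symm_apply_apply]⟩
  obtain ⟨π, hπ, hinv⟩ := exists_inversions_eq_zero col σ K univ C₀.symm ((hsymm C₀).1 h₀)
  rw [mem_rearrangements] at hπ
  have hE : ∀ i, col (π.symm i) = σ i := (hsymm π.symm).2 hπ.2
  have hmat : ∀ C : Equiv.Perm (Fin n), (∀ i, col (C i) = σ i) →
      mat C B = mat π.symm B + inversions col K univ C.symm := by
    intro C hC
    have := mat_sub_inversions B H hB hH col hcol hconv C π.symm
      (fun i => (hC i).trans (hE i).symm) K (hKC C hC)
    rw [Equiv.symm_symm, hinv] at this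
    push_cast at this
    linarith
  refine ⟨π.symm, hE, (isSorted_iff H col _ K (hKC _ hE)).2 hinv, fun C hC hs => ?_,
    fun C hC => ?_, ?_⟩
  · have := eq_of_inversions_eq_zero col σ K hK C.symm π ((hsymm C).1 hC) hπ.2
      ((isSorted_iff H col C K (hKC C hC)).1 hs) hinv
    rw [← this, Equiv.symm_symm]
  · rw [hmat C hC]
    simp
  · have e : ∑ C : Equiv.Perm (Fin n) with ∀ i, col (C i) = σ i,
        q ^ (inversions col K univ C.symm : ℤ) =
        ∑ ρ ∈ rearrangements col σ univ C₀.symm, q ^ (inversions col K univ ρ : ℤ) := by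
      refine sum_equiv (Equiv.inv _) (fun C => ?_) fun _ _ => rfl
      rw [mem_filter, mem_rearrangements, hsymm]
      simp
    rw [← prod_qNumber_fiber, ← sum_inversions col σ K hK univ C₀.symm ((hsymm C₀).1 h₀), ← e,
      mul_sum]
    refine sum_congr rfl fun C hC => ?_
    rw [hmat C (mem_filter.1 hC).2, zpow_add₀ q_ne_zero]

/-- On columns of constant height, the three clauses say that the rooks, read from left to right,
increase in `rowKey`. -/
lemma isStandard_iff (B : Finset (Fin n × Fin n)) (H : Fin n → ℕ)
    (hB : ∀ i j, (i, j) ∈ B ↔ (i : ℕ) < H j) (D : Finset (Fin n))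
    (hD : ∀ j ∈ D, ∀ k ∈ D, H j = H k) (C : Equiv.Perm (Fin n)) :
    IsStandard B D C ↔ ∀ i k, C i ∈ D → C k ∈ D →
      rowKey n (H (C i)) i < rowKey n (H (C k)) k → C i < C k := by
  constructor
  · rintro ⟨h1, h2, h3⟩ i k hi hk hlt
    have e := hD _ hi _ hk
    simp only [hB] at h1 h2 h3
    have h1 := h1 i k hi hk
    have h2 := h2 i k hi hk
    have h3 := h3 k i hk hi
    have := i.2
    have := k.2
    simp only [rowKey, Fin.lt_def] at *
    split_ifs at hlt <;> omega
  · intro h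
    refine ⟨fun i k hi hk => ?_, fun i k hi hk => ?_, fun i k hi hk => ?_⟩
    all_goals
      have e := hD _ hi _ hk
      have h1 := h i k hi hk
      have h2 := h k i hk hi
      have := i.2
      have := k.2
      simp only [hB, rowKey, Fin.lt_def] at *
      intros
      split_ifs at h1 h2 <;> omega

end

/-! ### Blocks, extensions of partial placements and factorization over a section. -/

section

variable {n t : ℕ}

lemma sum_Iic_le_sum_Iio (d : Fin t → ℕ) {b c : Fin t} (hbc : b < c) :
    ∑ i ∈ Iic b, d i ≤ ∑ i ∈ Iio c, d i :=
  sum_le_sum_of_subset fun _ hi => mem_Iio.2 ((mem_Iic.1 hi).trans_lt hbc)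

lemma exists_inBlock (d : Fin t → ℕ) (hn : ∑ b, d b = n) (j : Fin n) : ∃ b, InBlock d b j := by
  have ht : t ≠ 0 := by
    rintro rfl
    have := j.2
    simp at hn
    omega
  have hne : (univ.filter fun b : Fin t => (j : ℕ) < ∑ i ∈ Iic b, d i).Nonempty := by
    refine ⟨⟨t - 1, by omega⟩, mem_filter.2 ⟨mem_univ _, ?_⟩⟩
    have : Iic (⟨t - 1, by omega⟩ : Fin t) = univ := by
      ext i
      have := i.2
      simp only [mem_Iic, Fin.le_def, mem_univ, iff_true]
      omega
    rw [this, hn]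
    exact j.2
  -- The block of `j` is the first one whose right end lies beyond `j`; minimality puts the end of
  -- the preceding block at or before `j`.
  have hmem := min'_mem _ hne
  have hmin := fun b hb => min'_le (univ.filter fun b : Fin t => (j : ℕ) < ∑ i ∈ Iic b, d i) b hb
  set b := min' _ hne
  refine ⟨b, ?_, (mem_filter.1 hmem).2⟩
  by_contra hlt
  rw [not_le] at hlt
  have hb : (b : ℕ) ≠ 0 := by
    intro h0
    have : Iio b = ∅ := by
      ext i
      simp only [mem_Iio, Fin.lt_def, notMem_empty, iff_false]
      omega
    rw [this, sum_empty] at hlt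
    omega
  have hb' := b.2
  have hI : Iio b = Iic (⟨b - 1, by omega⟩ : Fin t) := by
    ext i
    simp only [mem_Iio, mem_Iic, Fin.lt_def, Fin.le_def]
    omega
  rw [hI] at hlt
  have := hmin _ (mem_filter.2 ⟨mem_univ _, hlt⟩)
  simp only [Fin.le_def] at this
  omega

lemma inBlock_le (d : Fin t → ℕ) {b c : Fin t} {j k : Fin n} (hb : InBlock d b j)
    (hc : InBlock d c k) (hjk : j ≤ k) : b ≤ c := by
  by_contra h
  have h1 := sum_Iic_le_sum_Iio d (not_le.1 h)
  have h2 := hb.1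
  have h3 := hc.2
  rw [Fin.le_def] at hjk
  omega

lemma card_inBlock (d : Fin t → ℕ) (hn : ∑ b, d b = n) (b : Fin t) :
    #{j : Fin n | InBlock d b j} = d b := by
  have h1 : ∑ i ∈ Iic b, d i = ∑ i ∈ Iio b, d i + d b := by
    rw [← Iio_insert, sum_insert (by simp), add_comm]
  have h2 : ∑ i ∈ Iic b, d i ≤ n := hn ▸ sum_le_sum_of_subset (subset_univ _)
  rw [← card_map Fin.valEmbedding]
  have : (univ.filter fun j : Fin n => InBlock d b j).map Fin.valEmbedding =
      Ico (∑ i ∈ Iio b, d i) (∑ i ∈ Iic b, d i) := by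
    ext x
    simp only [mem_map, mem_filter, mem_univ, true_and, Fin.valEmbedding_apply, mem_Ico]
    constructor
    · rintro ⟨j, hj, rfl⟩
      exact hj
    · intro hx
      exact ⟨⟨x, hx.2.trans_le h2⟩, hx, rfl⟩
  rw [this, Nat.card_Ico]
  omega

/-- A placement outside `D` extends to a placement of `n` rooks. -/
lemma exists_mem_extensions {D : Finset (Fin n)} {P : Finset (Fin n × Fin n)}
    (hP : IsPlacementOutside D P) : ∃ C, C ∈ extensions P := by
  classical
  -- The value off the rows of `P` is irrelevant: only the restriction of `f` to these rows is
  -- extended.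
  set f : Fin n → Fin n := fun i => if h : ∃ j, (i, j) ∈ P then h.choose else i with hf
  have hfP : ∀ s ∈ P, f s.1 = s.2 := by
    intro s hs
    have hex : ∃ j, (s.1, j) ∈ P := ⟨s.2, hs⟩
    have : f s.1 = hex.choose := dif_pos hex
    rw [this]
    exact congrArg Prod.snd (hP.row_inj _ hex.choose_spec s hs rfl)
  obtain ⟨g, hg⟩ := Finset.exists_equiv_extend_of_card_eq (t := (univ : Finset (Fin n)))
    (by simp) (s := P.image Prod.fst) (f := f) (subset_univ _) (by
      intro i hi k hk hik
      rw [mem_coe, mem_image] at hi hk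
      obtain ⟨s, hs, rfl⟩ := hi
      obtain ⟨s', hs', rfl⟩ := hk
      rw [hfP s hs, hfP s' hs'] at hik
      rw [hP.col_inj s hs s' hs' hik])
  refine ⟨g.trans (Equiv.subtypeUnivEquiv mem_univ), ?_⟩
  rw [extensions, mem_filter]
  refine ⟨mem_univ _, fun s hs => ?_⟩
  rw [Equiv.trans_apply, Equiv.subtypeUnivEquiv_apply, hg _ (mem_image_of_mem _ hs), hfP s hs]

/-- The colouring of the columns by which those of `D` share a colour and all others have a colour
of their own. -/
def sectionColor (D : Finset (Fin n)) (j : Fin n) : Option (Fin n) :=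
  if j ∈ D then none else some j

lemma sectionColor_eq_iff (D : Finset (Fin n)) (j k : Fin n) :
    sectionColor D j = sectionColor D k ↔ j = k ∨ (j ∈ D ∧ k ∈ D) := by
  unfold sectionColor
  split_ifs with h1 h2 h2 <;> simp [h1, h2]
  · rintro rfl
    contradiction
  · rintro rfl
    contradiction

lemma prod_qFactorial_sectionColor (D : Finset (Fin n)) :
    ∏ b, qFactorial #{j | sectionColor D j = b} = qFactorial #D := by
  rw [Fintype.prod_option]
  have h1 : (univ.filter fun j => sectionColor D j = none) = D := by
    ext j
    simp [sectionColor]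
  have h2 : ∀ k, qFactorial #{j | sectionColor D j = some k} = 1 := by
    intro k
    have hle : #{j | sectionColor D j = some k} ≤ 1 := by
      refine card_le_one.2 fun i hi j hj => ?_
      simp only [mem_filter, mem_univ, true_and] at hi hj
      have := (sectionColor_eq_iff D i j).1 (hi.trans hj.symm)
      refine this.resolve_right fun h => ?_
      simp [sectionColor, h.1] at hi
    interval_cases h : #{j | sectionColor D j = some k}
    · exact qFactorial_zero
    · rw [qFactorial_succ, qFactorial_zero, zero_add, qNumber_one, one_mul]
  rw [h1, prod_congr rfl fun k _ => h2 k, prod_const_one, mul_one]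

/-- By cardinality the rooks of `P` occupy every column outside `D`. Extending `P` therefore means
agreeing with `C₀` in those columns, which have colours of their own. -/
lemma mem_extensions_iff {D : Finset (Fin n)} {P : Finset (Fin n × Fin n)}
    (hP : IsPlacementOutside D P) {C₀ : Equiv.Perm (Fin n)} (h₀ : C₀ ∈ extensions P)
    (C : Equiv.Perm (Fin n)) :
    C ∈ extensions P ↔ ∀ i, sectionColor D (C i) = sectionColor D (C₀ i) := by
  have hcols : P.image Prod.snd = Dᶜ := by
    refine eq_of_subset_of_card_le (fun j hj => ?_) ?_
    · obtain ⟨s, hs, rfl⟩ := mem_image.1 hj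
      exact mem_compl.2 (hP.outside s hs)
    · rw [card_image_of_injOn fun s hs s' hs' h => hP.col_inj s hs s' hs' h, card_compl,
        Fintype.card_fin]
      have := hP.card_eq
      omega
  have hrow : ∀ C ∈ extensions P, ∀ i, C i ∉ D → (i, C i) ∈ P := by
    intro C hC i hi
    rw [← mem_compl, ← hcols, mem_image] at hi
    obtain ⟨s, hs, hsi⟩ := hi
    have := (mem_filter.1 hC).2 s hs
    rw [hsi] at this
    rw [← C.injective this, this, ← hsi]
    exact hs
  constructor
  · intro hC i
    rw [sectionColor_eq_iff]
    by_cases h1 : C i ∈ D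
    · by_cases h2 : C₀ i ∈ D
      · exact Or.inr ⟨h1, h2⟩
      · exact Or.inl ((mem_filter.1 hC).2 _ (hrow C₀ h₀ i h2))
    · exact Or.inl ((mem_filter.1 h₀).2 _ (hrow C hC i h1)).symm
  · intro h
    rw [extensions, mem_filter]
    refine ⟨mem_univ _, fun s hs => ?_⟩
    have e := (mem_filter.1 h₀).2 s hs
    have := h s.1
    rw [e, sectionColor_eq_iff] at this
    exact this.resolve_right fun h => hP.outside s hs h.2

/-- Minimization and factorization over a section. -/
theorem exists_standard_extension (B : Finset (Fin n × Fin n)) (H : Fin n → ℕ)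
    (hB : ∀ i j, (i, j) ∈ B ↔ (i : ℕ) < H j) (hH : ∀ j, H j ≤ n) (D : Finset (Fin n))
    (hconn : (D : Set (Fin n)).OrdConnected) (hD : ∀ j ∈ D, ∀ k ∈ D, H j = H k)
    (P : Finset (Fin n × Fin n)) (hP : IsPlacementOutside D P) :
    ∃ E ∈ extensions P, IsStandard B D E ∧
      (∀ C ∈ extensions P, IsStandard B D C → C = E) ∧
      (∀ C ∈ extensions P, mat E B ≤ mat C B) ∧
      ∑ C ∈ extensions P, q ^ mat C B = q ^ mat E B * qFactorial #D := by
  obtain ⟨C₀, h₀⟩ := exists_mem_extensions hP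
  have hmem := mem_extensions_iff hP h₀
  have hsorted : ∀ C, IsStandard B D C ↔ IsSorted H (sectionColor D) C := by
    intro C
    rw [isStandard_iff B H hB D hD]
    simp only [IsSorted, sectionColor_eq_iff]
    refine forall_congr' fun i => forall_congr' fun k => ⟨?_, fun h h1 h2 => h (Or.inr ⟨h1, h2⟩)⟩
    rintro h (h1 | h1) hlt
    · rw [C.injective h1] at hlt
      exact absurd hlt (lt_irrefl _)
    · exact h h1.1 h1.2 hlt
  obtain ⟨E, h1, h2, h3, h4, h5⟩ := exists_isSorted B H hB hH (sectionColor D)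
    (fun j k h => ((sectionColor_eq_iff D j k).1 h).elim (fun e => e ▸ rfl) fun e => hD _ e.1 _ e.2)
    (fun j k l hjk hkl h => by
      rw [sectionColor_eq_iff] at h ⊢
      rcases h with rfl | h
      · exact Or.inl (le_antisymm hkl hjk)
      · exact Or.inr ⟨hconn.out h.1 h.2 ⟨hjk, hkl⟩, h.1⟩)
    (fun i => sectionColor D (C₀ i)) C₀ fun _ => rfl
  refine ⟨E, (hmem E).2 h1, (hsorted E).2 h2, fun C hC hs => h3 C ((hmem C).1 hC) ((hsorted C).1 hs),
    fun C hC => h4 C ((hmem C).1 hC), ?_⟩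
  rw [← prod_qFactorial_sectionColor D, ← h5]
  refine sum_congr ?_ fun _ _ => rfl
  ext C
  rw [hmem, mem_filter, and_iff_right (mem_univ _)]

lemma exists_perm_of_card_eq {β : Type*} [DecidableEq β] (col σ : Fin n → β)
    (h : ∀ b, #{i | σ i = b} = #{j | col j = b}) :
    ∃ C : Equiv.Perm (Fin n), ∀ i, col (C i) = σ i := by
  have e : ∀ b, Nonempty ({i // σ i = b} ≃ {j // col j = b}) := fun b => by
    refine ⟨Fintype.equivOfCardEq ?_⟩
    rw [Fintype.card_subtype, Fintype.card_subtype, h]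
  exact ⟨Equiv.ofFiberEquiv fun b => (e b).some, Equiv.ofFiberEquiv_map _⟩

end

end FerrersMat

/-! ### Assembly of the theorem, with the columns coloured by blocks. -/

open FerrersMat Finset in
theorem theorem3 (n t : ℕ) (h d : Fin t → ℕ) (hd : ∀ b, 0 < d b) (hn : ∑ b, d b = n)
    (hh : ∑ b, h b ≤ n) :
    -- every multiset permutation has exactly one `B`-standard graph
    (∀ σ ∈ FerrersMat.multisetPerms n d, ∃! C : Equiv.Perm (Fin n),
      FerrersMat.IsGraph d σ C ∧ FerrersMat.IsBoardStandard h d C) ∧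
    -- `mat(·,B)` is multiset Mahonian
    (∑ σ ∈ FerrersMat.multisetPerms n d, FerrersMat.q ^ FerrersMat.matWord h d σ =
      FerrersMat.qMultinomial n d) ∧
    -- minimization and factorization over an arbitrary section `D` of `B`
    (∀ D : Finset (Fin n), FerrersMat.IsSection (FerrersMat.board n h d) D →
      ∀ P : Finset (Fin n × Fin n), FerrersMat.IsPlacementOutside D P →
        ∃ E ∈ FerrersMat.extensions P,
          FerrersMat.IsStandard (FerrersMat.board n h d) D E ∧
          (∀ C ∈ FerrersMat.extensions P,
            FerrersMat.IsStandard (FerrersMat.board n h d) D C → C = E) ∧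
          (∀ C ∈ FerrersMat.extensions P,
            FerrersMat.mat E (FerrersMat.board n h d) ≤
              FerrersMat.mat C (FerrersMat.board n h d)) ∧
          ∑ C ∈ FerrersMat.extensions P, FerrersMat.q ^ FerrersMat.mat C (FerrersMat.board n h d) =
            FerrersMat.q ^ FerrersMat.mat E (FerrersMat.board n h d) *
              FerrersMat.qFactorial D.card) := by
  choose blk hblk using exists_inBlock d hn
  have hblk_iff : ∀ b j, InBlock d b j ↔ blk j = b := fun b j =>
    ⟨fun hb => le_antisymm (inBlock_le d (hblk j) hb le_rfl) (inBlock_le d hb (hblk j) le_rfl),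
      fun hb => hb ▸ hblk j⟩
  have hblk_mono : Monotone blk := fun j k hjk => inBlock_le d (hblk j) (hblk k) hjk
  have hblk_card : ∀ b, #{j | blk j = b} = d b := fun b => by
    simp only [← hblk_iff]
    exact card_inBlock d hn b
  set B := board n h d with hBdef
  set H : Fin n → ℕ := fun j => ∑ i ∈ Iic (blk j), h i with hHdef
  have hH : ∀ j, H j ≤ n := fun j => (sum_le_sum_of_subset (subset_univ _)).trans hh
  have hHmono : Monotone H := fun j k hjk =>
    sum_le_sum_of_subset (Iic_subset_Iic.2 (hblk_mono hjk))
  have hB : ∀ i j, (i, j) ∈ B ↔ (i : ℕ) < H j := fun i j => by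
    simp [hBdef, board, hblk_iff, hHdef]
  have hheight : ∀ j, colHeight B j = H j := fun j => by
    simp [colHeight, hB, Fin.card_filter_val_lt, hH]
  have hcol : ∀ j k, blk j = blk k → H j = H k := fun j k e => by simp [hHdef, e]
  have hconv : ∀ j k l, j ≤ k → k ≤ l → blk j = blk l → blk k = blk j := fun j k l hjk hkl e =>
    le_antisymm ((hblk_mono hkl).trans e.ge) (hblk_mono hjk)
  have hgraph : ∀ (σ : Fin n → Fin t) C, IsGraph d σ C ↔ ∀ i, blk (C i) = σ i := fun σ C => by
    simp only [IsGraph, hblk_iff]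
  have hstd : ∀ C : Equiv.Perm (Fin n), IsBoardStandard h d C ↔ IsSorted H blk C := by
    intro C
    constructor
    · intro hC i k hik hlt
      have hconst : ∀ j ∈ (univ.filter fun j => blk j = blk (C i)),
          ∀ l ∈ (univ.filter fun j => blk j = blk (C i)), H j = H l := fun j hj l hl =>
        hcol j l ((mem_filter.1 hj).2.trans (mem_filter.1 hl).2.symm)
      -- A full block is itself a section, so testing standardness on full blocks suffices.
      have := hC (univ.filter fun j => blk j = blk (C i))
        ⟨⟨fun j hj l hl m hm => ?_⟩, fun j hj l hl => ?_⟩ ⟨blk (C i), fun j hj => ?_⟩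
      · exact (isStandard_iff B H hB _ hconst C).1 this i k (by simp) (by simp [hik]) hlt
      · simp only [coe_filter, mem_univ, true_and, Set.mem_ofPred_eq] at hj hl ⊢
        exact (hconv j m l hm.1 hm.2 (hj.trans hl.symm)).trans hj
      · rw [← hBdef, hheight, hheight, hconst j hj l hl]
      · exact (hblk_iff _ _).2 (mem_filter.1 hj).2
    · rintro hC D - ⟨b, hb⟩
      have hbD : ∀ j ∈ D, blk j = b := fun j hj => (hblk_iff b j).1 (hb j hj)
      refine (isStandard_iff B H hB D (fun j hj k hk => hcol j k ?_) C).2 fun i k hi hk =>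
        hC i k ?_
      · rw [hbD j hj, hbD k hk]
      · rw [hbD _ hi, hbD _ hk]
  have hmain : ∀ σ ∈ multisetPerms n d, ∃ E : Equiv.Perm (Fin n),
      (IsGraph d σ E ∧ IsBoardStandard h d E) ∧
      (∀ C : Equiv.Perm (Fin n), IsGraph d σ C ∧ IsBoardStandard h d C → C = E) ∧
      ∑ C : Equiv.Perm (Fin n) with (fun i => blk (C i)) = σ, q ^ mat C B =
        q ^ mat E B * ∏ b, qFactorial (d b) := by
    intro σ hσ
    obtain ⟨C₀, h₀⟩ := exists_perm_of_card_eq blk σ fun b => by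
      rw [hblk_card, (mem_filter.1 hσ).2 b]
    obtain ⟨E, h1, h2, h3, -, h5⟩ := exists_isSorted B H hB hH blk hcol hconv σ C₀ h₀
    refine ⟨E, ⟨(hgraph σ E).2 h1, (hstd E).2 h2⟩,
      fun C hC => h3 C ((hgraph σ C).1 hC.1) ((hstd C).1 hC.2), ?_⟩
    simp only [hblk_card] at h5
    rw [← h5]
    simp only [funext_iff]
  refine ⟨fun σ hσ => ?_, ?_, fun D hD P hP => ?_⟩
  · obtain ⟨E, h1, h2, -⟩ := hmain σ hσ
    exact ⟨E, h1, h2⟩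
  -- After clearing denominators, `[n]!` is written as the sum over all placements and split by the
  -- word of which each placement is a graph.
  · rw [qMultinomial, eq_div_iff (prod_ne_zero_iff.2 fun b _ => qFactorial_ne_zero _),
      ← sum_mat B H hB hH hHmono, sum_mul,
      ← sum_fiberwise_of_maps_to (s := (univ : Finset (Equiv.Perm (Fin n))))
        (t := multisetPerms n d) (g := fun C i => blk (C i))]
    · refine sum_congr rfl fun σ hσ => ?_
      obtain ⟨E, h1, h2, h3⟩ := hmain σ hσ
      have hE : standardGraph h d σ = E := h2 _ (Classical.epsilon_spec
        (p := fun C => IsGraph d σ C ∧ IsBoardStandard h d C) ⟨E, h1⟩)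
      rw [h3, matWord, hE]
    · intro C _
      rw [multisetPerms, mem_filter]
      refine ⟨mem_univ _, fun b => ?_⟩
      rw [← hblk_card b, ← card_map C.toEmbedding]
      congr 1
      ext j
      simp [mem_map_equiv]
  · exact exists_standard_extension B H hB hH D hD.1
      (fun j hj k hk => by rw [← hheight, ← hheight, hD.2 j hj k hk]) P hP
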